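/- Let $K$ be a field of characteristic different from $2$, let $p,q\in K\setminus\{0\}$ with $p^2=1$, and let $n\ge 2$. Let $L=\bigoplus_{i=1}^n\mathbb{Z}\varepsilon_i$ with $(\varepsilon_i)$ orthonormal, let $\alpha_0=2\varepsilon_1$, $\alpha'_0=\varepsilon_1+\varepsilon_2$ and $\alpha_i=\alpha'_i=\varepsilon_{i+1}-\varepsilon_i$ for $1\le i\le n-1$, and let $r_i$ (resp. $s_i$) be the orthogonal reflection of $L$ attached to $\alpha_i$ (resp. $\alpha'_i$). Put $q_0=p$ and $q_i=q$ for $1\le i\le n-1$. The affine Hecke algebra $\widehat H(B_n)$ is the unital $K$-algebra generated by $g_0,\dots,g_{n-1}$ and $X^x$ ($x\in L$) with the relations $X^0=1$, $X^xX^{x'}=X^{x+x'}$, $g_i^2=(q_i-q_i^{-1})g_i+1$, $g_0g_1g_0g_1=g_1g_0g_1g_0$, $g_ig_{i+1}g_i=g_{i+1}g_ig_{i+1}$ for $1\le i\le n-2$, $g_ig_j=g_jg_i$ for $|i-j|>1$, and $$g_iX^x-X^{r_i(x)}g_i=(q_i-q_i^{-1})\frac{X^x-X^{r_i(x)}}{1-X^{-\alpha_i}}\qquad(x\in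 L,\ 0\le i\le n-1).$$ The affine Hecke algebra $\widehat H(D_n)$ is the unital $K$-algebra generated by $T_0,\dots,T_{n-1}$ and $X^x$ ($x\in L$) with the relations $X^0=1$, $X^xX^{x'}=X^{x+x'}$, $T_i^2=(q-q^{-1})T_i+1$, $T_0T_2T_0=T_2T_0T_2$ (if $n\ge 3$), $T_0T_j=T_jT_0$ for $j\in\{1,\dots,n-1\}\setminus\{2\}$, $T_iT_{i+1}T_i=T_{i+1}T_iT_{i+1}$ for $1\le i\le n-2$, $T_iT_j=T_jT_i$ for $i,j\ge1$ with $|i-j|>1$, and $$T_iX^x-X^{s_i(x)}T_i=(q-q^{-1})\frac{X^x-X^{s_i(x)}}{1-X^{-\alpha'_i}}\qquad(x\in L,\ 0\le i\le n-1).$$ For $\lambda\in K\setminus\{0\}$ let $I_\lambda=\{\lambda^{\epsilon}q^{2k}\mid \epsilon\in\{1,-1\},\ k\in\mathbb{Z}\}$. Let $\boldsymbol\lambda=(\lambda_1,\dots,\lambda_l)$ be a tuple of elements of $K\setminus\{0\}$ such that the sets $I_{\lambda_a}$ are pairwise disjoint, let $S_{\boldsymbol\lambda}=I_{\lambda_1}\cup\dots\cup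 I_{\lambda_l}$, and let $m:S_{\boldsymbol\lambda}\to\mathbb{Z}_{\ge0}$ be a map with finite support. With $X_1=X^{\varepsilon_1}$, let $H(B_n)_{\boldsymbol\lambda,m}$ and $H(D_n)_{\boldsymbol\lambda,m}$ be the quotients of $\widehat H(B_n)$ and $\widehat H(D_n)$, respectively, by the relation $$\prod_{i\in S_{\boldsymbol\lambda}}(X_1-i)^{m(i)}=0.$$ Let $\tilde\eta$ be the involutive automorphism of $H(B_n)_{\boldsymbol\lambda,m}$ given by $g_0\mapsto -g_0$, $g_i\mapsto g_i$ for $1\le i\le n-1$, and $X^x\mapsto X^x$ for $x\in L$ (it is well defined because $p^2=1$). **Proposition.** Assume that $m(i^{-1})=m(i)$ for every $i\in S_{\boldsymbol\lambda}$. Then the $K$-algebra $H(D_n)_{\boldsymbol\lambda,m}$ is isomorphic to the fixed-point subalgebra $(H(B_n)_{\boldsymbol\lambda,m})^{\tilde\eta}=\{x\in H(B_n)_{\boldsymbol\lambda,m}\mid\tilde\eta(x)=x\}$. -/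

import Mathlib

open Polynomial

noncomputable section

namespace AffineHecke

/-! ### The lattice `L`, simple roots, coroots and reflections

The lattice `L = ⊕ ℤ ε_i` is `Fin n → ℤ`. Indices are shifted by one for the `ε`'s:
the coordinate `j : Fin n` is the coefficient of `ε_{j+1}`. Simple reflections and Hecke
generators are numbered `0, …, n-1`, as usual. -/

/-- The lattice `L = ⊕_{i=1}^n ℤ ε_i`. -/
abbrev Lattice (n : ℕ) : Type := Fin n → ℤ

/-- The basis vector `ε_{j+1}` of `L`. -/
def eps {n : ℕ} (j : Fin n) : Lattice n := Pi.single j 1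

/-- The vector `ε_{i+1} - ε_i` of `L`, for `1 ≤ i ≤ n-1`. -/
def rootA {n : ℕ} (i : Fin n) : Lattice n :=
  fun j => if j.val = i.val then 1 else if j.val + 1 = i.val then -1 else 0

/-- Simple roots of type `B`: `α_0 = 2 ε_1` and `α_i = ε_{i+1} - ε_i`, for `1 ≤ i ≤ n-1`. -/
def rootB {n : ℕ} (i : Fin n) : Lattice n :=
  if i.val = 0 then fun j => if j.val = 0 then 2 else 0 else rootA i

/-- Simple roots of type `D`: `α'_0 = ε_1 + ε_2` and `α'_i = ε_{i+1} - ε_i`, for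
`1 ≤ i ≤ n-1`. -/
def rootD {n : ℕ} (i : Fin n) : Lattice n :=
  if i.val = 0 then fun j => if j.val ≤ 1 then 1 else 0 else rootA i

/-- The coroot `α^∨(x) = 2 (α, x) / (α, α)`; the integer division is exact for all simple roots
used here, see `coroot_rootB_zero`, `coroot_rootB_pos`, `coroot_rootD_zero`,
`coroot_rootD_pos`. -/
def coroot {n : ℕ} (α x : Lattice n) : ℤ := 2 * (α ⬝ᵥ x) / (α ⬝ᵥ α)

/-- The reflection `r_α(x) = x - α^∨(x) α`. -/
def reflect {n : ℕ} (α x : Lattice n) : Lattice n := x - coroot α x • α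

theorem rootB_zero {n : ℕ} (i : Fin n) (hi : i.val = 0) : rootB i = (2 : ℤ) • eps i := by
  funext j
  by_cases h : j = i
  · subst h; simp [rootB, eps, hi]
  · have : j.val ≠ 0 := fun h' => h (Fin.ext (by omega))
    simp [rootB, eps, hi, h, this]

theorem rootD_zero {n : ℕ} (i j : Fin n) (hi : i.val = 0) (hj : j.val = 1) :
    rootD i = eps i + eps j := by
  funext k
  have hij : i ≠ j := fun h => by rw [h] at hi; omega
  by_cases h : k = i
  · subst h; simp [rootD, eps, hi, hij]
  · by_cases h' : k = j
    · subst h'; simp [rootD, eps, hi, hj, hij.symm]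
    · have h0 : ¬ k.val ≤ 1 := fun h'' => by
        rcases Nat.le_one_iff_eq_zero_or_eq_one.mp h'' with h'' | h''
        · exact h (Fin.ext (by omega))
        · exact h' (Fin.ext (by omega))
      simp [rootD, eps, hi, h, h', h0]

theorem rootA_eq {n : ℕ} (i j : Fin n) (hij : j.val + 1 = i.val) : rootA i = eps i - eps j := by
  funext k
  have hne : i ≠ j := fun h => by rw [h] at hij; omega
  by_cases h : k = i
  · subst h; simp [rootA, eps, hne]
  · have hk : k.val ≠ i.val := fun h' => h (Fin.ext h')
    by_cases h' : k = j
    · subst h'; simp [rootA, eps, hij, hne.symm, hk]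
    · have : k.val + 1 ≠ i.val := fun h'' => h' (Fin.ext (by omega))
      simp [rootA, eps, h, h', hk, this]

theorem rootB_pos {n : ℕ} (i j : Fin n) (hij : j.val + 1 = i.val) : rootB i = eps i - eps j := by
  rw [rootB, if_neg (by omega), rootA_eq i j hij]

theorem rootD_pos {n : ℕ} (i j : Fin n) (hij : j.val + 1 = i.val) : rootD i = eps i - eps j := by
  rw [rootD, if_neg (by omega), rootA_eq i j hij]

theorem coroot_rootB_zero {n : ℕ} (i : Fin n) (hi : i.val = 0) (x : Lattice n) :
    coroot (rootB i) x = x i := by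
  rw [rootB_zero i hi, coroot]
  simp only [smul_dotProduct, dotProduct_smul, eps, single_dotProduct, Pi.single_eq_same,
    smul_eq_mul]
  omega

theorem coroot_rootB_pos {n : ℕ} (i j : Fin n) (hij : j.val + 1 = i.val) (x : Lattice n) :
    coroot (rootB i) x = x i - x j := by
  have hne : i ≠ j := fun h => by rw [h] at hij; omega
  rw [rootB_pos i j hij, coroot]
  simp [eps, sub_dotProduct, dotProduct_sub, hne, hne.symm]

theorem coroot_rootD_zero {n : ℕ} (i j : Fin n) (hi : i.val = 0) (hj : j.val = 1)
    (x : Lattice n) : coroot (rootD i) x = x i + x j := by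
  have hne : i ≠ j := fun h => by rw [h] at hi; omega
  rw [rootD_zero i j hi hj, coroot]
  simp [eps, add_dotProduct, dotProduct_add, hne, hne.symm]

theorem coroot_rootD_pos {n : ℕ} (i j : Fin n) (hij : j.val + 1 = i.val) (x : Lattice n) :
    coroot (rootD i) x = x i - x j := by
  rw [rootD_pos i j hij, ← rootB_pos i j hij, coroot_rootB_pos i j hij]

/-- The exact quotient `(X^x - X^{r_α(x)}) / (1 - X^{-α})`, written out: with `k = α^∨(x)`, it
is `∑_{0 ≤ j < k} X^{x - jα}` if `k ≥ 0`, and `-∑_{1 ≤ j ≤ -k} X^{x + jα}` if `k < 0`.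
The lemma `one_sub_mul_divDiff` shows that it is the quotient
(which is unique, the group algebra of `L` being a domain). -/
def divDiff {n : ℕ} {A : Type*} [Ring A] (X : Lattice n → A) (α x : Lattice n) : A :=
  if 0 ≤ coroot α x then
    ∑ j ∈ Finset.range (coroot α x).toNat, X (x - (j : ℤ) • α)
  else
    -∑ j ∈ Finset.range (-coroot α x).toNat, X (x + ((j : ℤ) + 1) • α)

theorem one_sub_mul_divDiff {n : ℕ} {A : Type*} [Ring A] (X : Lattice n → A)
    (hX : ∀ x y, X x * X y = X (x + y)) (α x : Lattice n) :
    (1 - X (-α)) * divDiff X α x = X x - X (reflect α x) := by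
  have key : ∀ (N : ℕ) (y : Lattice n),
      (1 - X (-α)) * ∑ j ∈ Finset.range N, X (y - (j : ℤ) • α) = X y - X (y - (N : ℤ) • α) := by
    intro N y
    induction N with
    | zero => simp
    | succ N ih =>
      rw [Finset.sum_range_succ, mul_add, ih, sub_mul, one_mul, hX]
      have : -α + (y - (N : ℤ) • α) = y - ((N + 1 : ℕ) : ℤ) • α := by
        push_cast; rw [add_smul, one_smul]; abel
      rw [this]; abel
  have key' : ∀ (N : ℕ) (y : Lattice n),
      (1 - X (-α)) * ∑ j ∈ Finset.range N, X (y + ((j : ℤ) + 1) • α)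
        = X (y + (N : ℤ) • α) - X y := by
    intro N y
    induction N with
    | zero => simp
    | succ N ih =>
      rw [Finset.sum_range_succ, mul_add, ih, sub_mul, one_mul, hX]
      have : -α + (y + ((N : ℤ) + 1) • α) = y + (N : ℤ) • α := by
        rw [add_smul, one_smul]; abel
      rw [this]; push_cast; abel
  unfold divDiff reflect
  split_ifs with h
  · rw [key, Int.toNat_of_nonneg h]
  · rw [mul_neg, key', Int.toNat_of_nonneg (by omega), neg_smul, ← sub_eq_add_neg]
    abel

/-! ### Affine Hecke algebras -/

/-- Generators: `g i` for `0 ≤ i ≤ n-1` (the `g_i` in type `B`, the `T_i` in type `D`) and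
`X x`, standing for `X^x`, for `x ∈ L`. -/
inductive Gen (n : ℕ) : Type
  | g (i : Fin n) : Gen n
  | X (x : Lattice n) : Gen n

variable {K : Type*} [Field K]

/-- The generator `g_i`, resp. `T_i`, in the free algebra. -/
abbrev fg (K : Type*) [Field K] {n : ℕ} (i : Fin n) : FreeAlgebra K (Gen n) :=
  FreeAlgebra.ι K (Gen.g i)

/-- The generator `X^x` in the free algebra. -/
abbrev fX (K : Type*) [Field K] {n : ℕ} (x : Lattice n) : FreeAlgebra K (Gen n) :=
  FreeAlgebra.ι K (Gen.X x)

/-- The parameters `q_0 = p` and `q_i = q` for `1 ≤ i ≤ n-1`. -/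
def param {n : ℕ} (p q : K) (i : Fin n) : K := if i.val = 0 then p else q

/-- Defining relations of the affine Hecke algebra of type `B_n` with parameters `p, q`. -/
inductive RelB (n : ℕ) (p q : K) : FreeAlgebra K (Gen n) → FreeAlgebra K (Gen n) → Prop
  | X_zero : RelB n p q (fX K 0) 1
  | X_mul (x y : Lattice n) : RelB n p q (fX K x * fX K y) (fX K (x + y))
  | quad (i : Fin n) : RelB n p q (fg K i ^ 2) ((param p q i - (param p q i)⁻¹) • fg K i + 1)
  | braid4 (i j : Fin n) (hi : i.val = 0) (hj : j.val = 1) :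
      RelB n p q (fg K i * fg K j * fg K i * fg K j) (fg K j * fg K i * fg K j * fg K i)
  | braid3 (i j : Fin n) (hi : 1 ≤ i.val) (hij : j.val = i.val + 1) :
      RelB n p q (fg K i * fg K j * fg K i) (fg K j * fg K i * fg K j)
  | comm (i j : Fin n) (hij : i.val + 1 < j.val) :
      RelB n p q (fg K i * fg K j) (fg K j * fg K i)
  | lusztig (i : Fin n) (x : Lattice n) :
      RelB n p q (fg K i * fX K x - fX K (reflect (rootB i) x) * fg K i)
        ((param p q i - (param p q i)⁻¹) • divDiff (fX K) (rootB i) x)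

/-- Defining relations of the affine Hecke algebra of type `D_n` (with respect to the
lattice `L`) with parameter `q`. -/
inductive RelD (n : ℕ) (q : K) : FreeAlgebra K (Gen n) → FreeAlgebra K (Gen n) → Prop
  | X_zero : RelD n q (fX K 0) 1
  | X_mul (x y : Lattice n) : RelD n q (fX K x * fX K y) (fX K (x + y))
  | quad (i : Fin n) : RelD n q (fg K i ^ 2) ((q - q⁻¹) • fg K i + 1)
  | braid_zero_two (i j : Fin n) (hi : i.val = 0) (hj : j.val = 2) :
      RelD n q (fg K i * fg K j * fg K i) (fg K j * fg K i * fg K j)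
  | comm_zero (i j : Fin n) (hi : i.val = 0) (hj : 1 ≤ j.val) (hj2 : j.val ≠ 2) :
      RelD n q (fg K i * fg K j) (fg K j * fg K i)
  | braid3 (i j : Fin n) (hi : 1 ≤ i.val) (hij : j.val = i.val + 1) :
      RelD n q (fg K i * fg K j * fg K i) (fg K j * fg K i * fg K j)
  | comm (i j : Fin n) (hi : 1 ≤ i.val) (hij : i.val + 1 < j.val) :
      RelD n q (fg K i * fg K j) (fg K j * fg K i)
  | lusztig (i : Fin n) (x : Lattice n) :
      RelD n q (fg K i * fX K x - fX K (reflect (rootD i) x) * fg K i)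
        ((q - q⁻¹) • divDiff (fX K) (rootD i) x)

/-- The affine Hecke algebra `Ĥ(B_n)`. -/
def AffB (n : ℕ) (p q : K) : Type _ := RingQuot (RelB n p q)

instance (n : ℕ) (p q : K) : Semiring (AffB n p q) :=
  inferInstanceAs (Semiring (RingQuot (RelB n p q)))

instance (n : ℕ) (p q : K) : Algebra K (AffB n p q) :=
  inferInstanceAs (Algebra K (RingQuot (RelB n p q)))

instance (n : ℕ) (p q : K) : Ring (AffB n p q) := Algebra.semiringToRing K

/-- The affine Hecke algebra `Ĥ(D_n)`. -/
def AffD (n : ℕ) (q : K) : Type _ := RingQuot (RelD n q)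

instance (n : ℕ) (q : K) : Semiring (AffD n q) :=
  inferInstanceAs (Semiring (RingQuot (RelD n q)))

instance (n : ℕ) (q : K) : Algebra K (AffD n q) :=
  inferInstanceAs (Algebra K (RingQuot (RelD n q)))

instance (n : ℕ) (q : K) : Ring (AffD n q) := Algebra.semiringToRing K

/-- The quotient map from the free algebra to `Ĥ(B_n)`. -/
def affBMk (n : ℕ) (p q : K) : FreeAlgebra K (Gen n) →ₐ[K] AffB n p q :=
  RingQuot.mkAlgHom K (RelB n p q)

/-- The quotient map from the free algebra to `Ĥ(D_n)`. -/
def affDMk (n : ℕ) (q : K) : FreeAlgebra K (Gen n) →ₐ[K] AffD n q :=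
  RingQuot.mkAlgHom K (RelD n q)

/-- The element `g_i` of `Ĥ(B_n)`. -/
def gB {n : ℕ} (p q : K) (i : Fin n) : AffB n p q := affBMk n p q (fg K i)

/-- The element `X^x` of `Ĥ(B_n)`. -/
def XB {n : ℕ} (p q : K) (x : Lattice n) : AffB n p q :=
  affBMk n p q (fX K x)

/-- The element `T_i` of `Ĥ(D_n)`. -/
def TD {n : ℕ} (q : K) (i : Fin n) : AffD n q := affDMk n q (fg K i)

/-- The element `X^x` of `Ĥ(D_n)`. -/
def XD {n : ℕ} (q : K) (x : Lattice n) : AffD n q := affDMk n q (fX K x)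

/-! ### Cyclotomic quotients -/

/-- The set `I_λ = {λ^ε q^{2l} | ε ∈ {1, -1}, l ∈ ℤ}`. -/
def orbitSet (q a : K) : Set K := {x | ∃ l : ℤ, x = a * q ^ (2 * l) ∨ x = a⁻¹ * q ^ (2 * l)}

/-- The set `S_λ = I_{λ_1} ∪ … ∪ I_{λ_l}`. -/
def vertexSet {l : ℕ} (q : K) (lam : Fin l → K) : Set K := ⋃ a, orbitSet q (lam a)

theorem inv_mem_vertexSet {l : ℕ} {q : K} {lam : Fin l → K} {x : K}
    (hx : x ∈ vertexSet q lam) : x⁻¹ ∈ vertexSet q lam := by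
  obtain ⟨a, k, h⟩ := Set.mem_iUnion.mp hx
  refine Set.mem_iUnion.mpr ⟨a, -k, ?_⟩
  rcases h with rfl | rfl
  · right; rw [mul_inv, ← zpow_neg, mul_neg]
  · left; rw [mul_inv, inv_inv, ← zpow_neg, mul_neg]

/-- The involution `i ↦ i⁻¹` of `S_λ`. -/
def vinv {l : ℕ} {q : K} {lam : Fin l → K} (i : vertexSet q lam) : vertexSet q lam :=
  ⟨(i : K)⁻¹, inv_mem_vertexSet i.2⟩

/-- The polynomial `P = ∏_{i ∈ S_λ} (X - i)^{m(i)}`, for a multiplicity map `m : S_λ → ℕ` with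
finite support. -/
def cycPoly {l : ℕ} {q : K} {lam : Fin l → K} (m : vertexSet q lam →₀ ℕ) : K[X] :=
  m.prod fun i k => (X - C (i : K)) ^ k

/-- The relation `P(X_1) = 0` in `Ĥ(B_n)`, where `X_1 = X^{ε_1}`. -/
inductive CycRelB (n : ℕ) (p : K) {q : K} {l : ℕ} {lam : Fin l → K}
    (m : vertexSet q lam →₀ ℕ) : AffB n p q → AffB n p q → Prop
  | rel (i : Fin n) (hi : i.val = 0) :
      CycRelB n p m (aeval (XB p q (eps i)) (cycPoly m)) 0

/-- The relation `P(X_1) = 0` in `Ĥ(D_n)`, where `X_1 = X^{ε_1}`. -/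
inductive CycRelD (n : ℕ) {q : K} {l : ℕ} {lam : Fin l → K}
    (m : vertexSet q lam →₀ ℕ) : AffD n q → AffD n q → Prop
  | rel (i : Fin n) (hi : i.val = 0) :
      CycRelD n m (aeval (XD q (eps i)) (cycPoly m)) 0

/-- The cyclotomic quotient `H(B_n)_{λ,m}`. -/
def CycB (n : ℕ) (p : K) {q : K} {l : ℕ} {lam : Fin l → K} (m : vertexSet q lam →₀ ℕ) :
    Type _ := RingQuot (CycRelB n p m)

instance (n : ℕ) (p : K) {q : K} {l : ℕ} {lam : Fin l → K} (m : vertexSet q lam →₀ ℕ) :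
    Semiring (CycB n p m) := inferInstanceAs (Semiring (RingQuot (CycRelB n p m)))

instance (n : ℕ) (p : K) {q : K} {l : ℕ} {lam : Fin l → K} (m : vertexSet q lam →₀ ℕ) :
    Algebra K (CycB n p m) := inferInstanceAs (Algebra K (RingQuot (CycRelB n p m)))

instance (n : ℕ) (p : K) {q : K} {l : ℕ} {lam : Fin l → K} (m : vertexSet q lam →₀ ℕ) :
    Ring (CycB n p m) := Algebra.semiringToRing K

/-- The cyclotomic quotient `H(D_n)_{λ,m}`. -/
def CycD (n : ℕ) {q : K} {l : ℕ} {lam : Fin l → K} (m : vertexSet q lam →₀ ℕ) :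
    Type _ := RingQuot (CycRelD n m)

instance (n : ℕ) {q : K} {l : ℕ} {lam : Fin l → K} (m : vertexSet q lam →₀ ℕ) :
    Semiring (CycD n m) := inferInstanceAs (Semiring (RingQuot (CycRelD n m)))

instance (n : ℕ) {q : K} {l : ℕ} {lam : Fin l → K} (m : vertexSet q lam →₀ ℕ) :
    Algebra K (CycD n m) := inferInstanceAs (Algebra K (RingQuot (CycRelD n m)))

instance (n : ℕ) {q : K} {l : ℕ} {lam : Fin l → K} (m : vertexSet q lam →₀ ℕ) :
    Ring (CycD n m) := Algebra.semiringToRing K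

/-- The quotient map `Ĥ(B_n) → H(B_n)_{λ,m}`. -/
def cycBMk (n : ℕ) (p : K) {q : K} {l : ℕ} {lam : Fin l → K} (m : vertexSet q lam →₀ ℕ) :
    AffB n p q →ₐ[K] CycB n p m := RingQuot.mkAlgHom K (CycRelB n p m)

/-! ### The involution `g_0 ↦ -g_0` -/

/-- The sign of a generator: `-1` for `g_0`, and `1` for the others. -/
def etaVal {n : ℕ} (p q : K) : Gen n → AffB n p q
  | Gen.g i => if i.val = 0 then -gB p q i else gB p q i
  | Gen.X x => XB p q x

theorem map_divDiff {n : ℕ} {A B : Type*} [Ring A] [Ring B] (f : A →+* B) (X : Lattice n → A)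
    (α x : Lattice n) : f (divDiff X α x) = divDiff (fun y => f (X y)) α x := by
  unfold divDiff
  split_ifs <;> simp

theorem affBMk_rel {n : ℕ} {p q : K} {a b : FreeAlgebra K (Gen n)} (h : RelB n p q a b) :
    affBMk n p q a = affBMk n p q b := RingQuot.mkAlgHom_rel K h

theorem etaVal_rel {n : ℕ} {p : K} (q : K) (hp : p ^ 2 = 1) ⦃a b : FreeAlgebra K (Gen n)⦄
    (h : RelB n p q a b) :
    FreeAlgebra.lift K (etaVal p q) a = FreeAlgebra.lift K (etaVal p q) b := by
  have hp0 : p - p⁻¹ = 0 := by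
    have : p ≠ 0 := by rintro rfl; simp at hp
    field_simp; rw [hp]; ring
  have hr := affBMk_rel h
  cases h with
  | X_zero => simpa [etaVal, XB] using hr
  | X_mul x y => simpa [etaVal, XB] using hr
  | quad i =>
    by_cases hi : i.val = 0
    · simpa [etaVal, gB, hi, param, hp0] using hr
    · simpa [etaVal, gB, hi, param] using hr
  | braid4 i j hi hj => simpa [etaVal, gB, hi, hj] using hr
  | braid3 i j hi hij =>
    have h1 : i.val ≠ 0 := by omega
    have h2 : j.val ≠ 0 := by omega
    simpa [etaVal, gB, h1, h2] using hr
  | comm i j hij =>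
    have h2 : j.val ≠ 0 := by omega
    by_cases hi : i.val = 0
    · simpa [etaVal, gB, h2, hi] using hr
    · simpa [etaVal, gB, h2, hi] using hr
  | lusztig i x =>
    by_cases hi : i.val = 0
    · simp only [param, hi, if_true, hp0, zero_smul, map_zero, map_sub, map_mul] at hr ⊢
      simp only [FreeAlgebra.lift_ι_apply, etaVal, hi, if_true, gB, XB]
      rw [neg_mul, mul_neg, ← neg_sub', hr, neg_zero]
    · have e1 := map_divDiff (FreeAlgebra.lift K (etaVal (n := n) p q)).toRingHom
        (fX K) (rootB i) x
      have e2 := map_divDiff (affBMk n p q).toRingHom (fX K) (rootB i) x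
      simp only [AlgHom.toRingHom_eq_coe, RingHom.coe_coe, FreeAlgebra.lift_ι_apply, etaVal, XB] at e1 e2
      simp only [map_sub, map_mul, map_smul, e1, e2] at hr ⊢
      simpa [etaVal, gB, XB, hi] using hr

/-- The endomorphism `η` of `Ĥ(B_n)`, for `p² = 1`:
`g_0 ↦ -g_0`, `g_i ↦ g_i` for `i ≥ 1`, and `X^x ↦ X^x`. -/
def eta (n : ℕ) {p : K} (q : K) (hp : p ^ 2 = 1) : AffB n p q →ₐ[K] AffB n p q :=
  RingQuot.liftAlgHom K ⟨FreeAlgebra.lift K (etaVal p q), etaVal_rel q hp⟩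

theorem eta_mk {n : ℕ} {p : K} (q : K) (hp : p ^ 2 = 1) (a : FreeAlgebra K (Gen n)) :
    eta n q hp (affBMk n p q a) = FreeAlgebra.lift K (etaVal p q) a :=
  RingQuot.liftAlgHom_mkAlgHom_apply K (FreeAlgebra.lift K (etaVal p q)) (etaVal_rel q hp) a

theorem eta_gB {n : ℕ} {p : K} (q : K) (hp : p ^ 2 = 1) (i : Fin n) :
    eta n q hp (gB p q i) = if i.val = 0 then -gB p q i else gB p q i := by
  rw [gB, eta_mk, FreeAlgebra.lift_ι_apply]; rfl

theorem eta_XB {n : ℕ} {p : K} (q : K) (hp : p ^ 2 = 1) (x : Lattice n) :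
    eta n q hp (XB p q x) = XB p q x := by
  rw [XB, eta_mk, FreeAlgebra.lift_ι_apply]; rfl

theorem eta_comp_eta (n : ℕ) {p : K} (q : K) (hp : p ^ 2 = 1) :
    (eta n q hp).comp (eta n q hp) = AlgHom.id K _ := by
  apply RingQuot.ringQuot_ext'
  apply FreeAlgebra.hom_ext
  funext s
  cases s with
  | g i =>
    change eta n q hp (eta n q hp (gB p q i)) = gB p q i
    rw [eta_gB]
    split_ifs with h
    · rw [map_neg, eta_gB, if_pos h, neg_neg]
    · rw [eta_gB, if_neg h]
  | X x =>
    change eta n q hp (eta n q hp (XB p q x)) = XB p q x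
    rw [eta_XB, eta_XB]

section Cyclotomic

variable {l : ℕ} {q : K} {lam : Fin l → K}

theorem eta_cycRel (n : ℕ) {p : K} (hp : p ^ 2 = 1) (m : vertexSet q lam →₀ ℕ)
    ⦃a b : AffB n p q⦄ (h : CycRelB n p m a b) :
    ((cycBMk n p m).comp (eta n q hp)) a = ((cycBMk n p m).comp (eta n q hp)) b := by
  have hr := RingQuot.mkAlgHom_rel K h
  cases h with
  | rel i hi =>
    rw [AlgHom.comp_apply, AlgHom.comp_apply, ← aeval_algHom_apply (eta n q hp), eta_XB,
      map_zero]
    exact hr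

/-- The endomorphism of `H(B_n)_{λ,m}` induced by `η`. -/
def etaCycHom (n : ℕ) {p : K} (hp : p ^ 2 = 1) (m : vertexSet q lam →₀ ℕ) :
    CycB n p m →ₐ[K] CycB n p m :=
  RingQuot.liftAlgHom K ⟨(cycBMk n p m).comp (eta n q hp), eta_cycRel n hp m⟩

theorem etaCycHom_mk (n : ℕ) {p : K} (hp : p ^ 2 = 1) (m : vertexSet q lam →₀ ℕ)
    (x : AffB n p q) : etaCycHom n hp m (cycBMk n p m x) = cycBMk n p m (eta n q hp x) :=
  RingQuot.liftAlgHom_mkAlgHom_apply K ((cycBMk n p m).comp (eta n q hp)) (eta_cycRel n hp m) x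

theorem etaCycHom_comp (n : ℕ) {p : K} (hp : p ^ 2 = 1) (m : vertexSet q lam →₀ ℕ) :
    (etaCycHom n hp m).comp (etaCycHom n hp m) = AlgHom.id K _ := by
  apply RingQuot.ringQuot_ext'
  refine AlgHom.ext fun x => ?_
  change etaCycHom n hp m (etaCycHom n hp m (cycBMk n p m x)) = cycBMk n p m x
  rw [etaCycHom_mk, etaCycHom_mk]
  exact congrArg _ (DFunLike.congr_fun (eta_comp_eta n q hp) x)

/-- The involutive automorphism of `H(B_n)_{λ,m}` induced by `η`, for `p² = 1`:
`g_0 ↦ -g_0`, `g_i ↦ g_i` for `i ≥ 1`, and `X^x ↦ X^x`. -/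
def etaCyc (n : ℕ) {p : K} (hp : p ^ 2 = 1) (m : vertexSet q lam →₀ ℕ) :
    CycB n p m ≃ₐ[K] CycB n p m :=
  AlgEquiv.ofAlgHom (etaCycHom n hp m) (etaCycHom n hp m)
    (etaCycHom_comp n hp m) (etaCycHom_comp n hp m)

/-- The subalgebra of fixed points of an automorphism `θ` of a `K`-algebra. -/
def fixedSubalgebra {A : Type*} [Semiring A] [Algebra K A] (θ : A ≃ₐ[K] A) : Subalgebra K A where
  carrier := {x | θ x = x}
  mul_mem' {a b} ha hb := by
    change θ (a * b) = a * b
    rw [map_mul, show θ a = a from ha, show θ b = b from hb]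
  add_mem' {a b} ha hb := by
    change θ (a + b) = a + b
    rw [map_add, show θ a = a from ha, show θ b = b from hb]
  algebraMap_mem' r := θ.commutes r

end Cyclotomic

end AffineHecke

end

/-! Since `p ^ 2 = 1`, the parameter `p - p⁻¹` vanishes. Hence in type `B` the generator `g_0` is an
involution, and it moves past `X^x` with no correction term, only replacing `x` by its image under
the sign change of the first coordinate (`flip`). Putting `T_0 = g_0 g_1 g_0` and `T_i = g_i` for `i
≥ 1` then gives a family of type `D` (`IsHeckeB.isHeckeD`), hence a homomorphism `inclusion` from
the cyclotomic algebra of type `D` to that of type `B`.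

Conjugation by `g_0` corresponds on the type `D` side to the diagram automorphism `sigma`, which
exchanges `T_0` and `T_1` and applies `flip` to the lattice. It sends `X_1` to `X_1⁻¹`, so it
descends to the quotient because the multiplicities are invariant under inversion: the cyclotomic
polynomial is then self-reciprocal up to a unit factor (`aeval_cycPoly_eq_zero_of_inv`).

The type `B` algebra is in effect the crossed product of the type `D` algebra with the group of
order two generated by `sigma`. Every element has the form `ι(a) + ι(b) g_0`, where `ι` is
`inclusion` (`exists_inclusion_add`). Injectivity of `ι` needs no basis theorem: the crossed product
acts by 2 × 2 matrices over the type `D` algebra, and `ι(a)` acts as `diag(a, σ(a))`, which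
determines `a` (`inclusion_injective`). The involution fixes `ι(a)` and negates `ι(b) g_0`, so in
characteristic different from 2 its fixed points are exactly the image of `ι`
(`exists_inclusion_eq`). -/

noncomputable section

namespace AffineHecke

/-! ### Families satisfying the Hecke relations -/

section Families

variable {K : Type*} [Field K] {A B : Type*} [Ring A] [Algebra K A] [Ring B] [Algebra K B]

/-- A pair of families in a `K`-algebra satisfying the defining relations of `Ĥ(B_n)`. -/
structure IsHeckeB {n : ℕ} (p q : K) (g : Fin n → A) (X : Lattice n → A) : Prop where
  X_zero : X 0 = 1
  X_mul (x y : Lattice n) : X x * X y = X (x + y)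
  quad (i : Fin n) : g i ^ 2 = (param p q i - (param p q i)⁻¹) • g i + 1
  braid4 (i j : Fin n) (hi : i.val = 0) (hj : j.val = 1) :
    g i * g j * g i * g j = g j * g i * g j * g i
  braid3 (i j : Fin n) (hi : 1 ≤ i.val) (hij : j.val = i.val + 1) :
    g i * g j * g i = g j * g i * g j
  comm (i j : Fin n) (hij : i.val + 1 < j.val) : g i * g j = g j * g i
  lusztig (i : Fin n) (x : Lattice n) :
    g i * X x - X (reflect (rootB i) x) * g i
      = (param p q i - (param p q i)⁻¹) • divDiff X (rootB i) x

/-- A pair of families in a `K`-algebra satisfying the defining relations of `Ĥ(D_n)`. -/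
structure IsHeckeD {n : ℕ} (q : K) (T : Fin n → A) (X : Lattice n → A) : Prop where
  X_zero : X 0 = 1
  X_mul (x y : Lattice n) : X x * X y = X (x + y)
  quad (i : Fin n) : T i ^ 2 = (q - q⁻¹) • T i + 1
  braid_zero_two (i j : Fin n) (hi : i.val = 0) (hj : j.val = 2) :
    T i * T j * T i = T j * T i * T j
  comm_zero (i j : Fin n) (hi : i.val = 0) (hj : 1 ≤ j.val) (hj2 : j.val ≠ 2) :
    T i * T j = T j * T i
  braid3 (i j : Fin n) (hi : 1 ≤ i.val) (hij : j.val = i.val + 1) :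
    T i * T j * T i = T j * T i * T j
  comm (i j : Fin n) (hi : 1 ≤ i.val) (hij : i.val + 1 < j.val) : T i * T j = T j * T i
  lusztig (i : Fin n) (x : Lattice n) :
    T i * X x - X (reflect (rootD i) x) * T i = (q - q⁻¹) • divDiff X (rootD i) x

theorem map_divDiff_algHom {n : ℕ} (f : A →ₐ[K] B) (X : Lattice n → A) (α x : Lattice n) :
    f (divDiff X α x) = divDiff (fun y => f (X y)) α x :=
  map_divDiff (f : A →+* B) X α x

theorem affDMk_rel {n : ℕ} {q : K} {a b : FreeAlgebra K (Gen n)} (h : RelD n q a b) :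
    affDMk n q a = affDMk n q b := RingQuot.mkAlgHom_rel K h

theorem isHeckeB_mk (n : ℕ) (p q : K) : IsHeckeB p q (gB (n := n) p q) (XB p q) where
  X_zero := by simpa [XB] using affBMk_rel (.X_zero (n := n) (p := p) (q := q))
  X_mul x y := by simpa [XB] using affBMk_rel (.X_mul (p := p) (q := q) x y)
  quad i := by simpa [gB] using affBMk_rel (.quad (p := p) (q := q) i)
  braid4 i j hi hj := by simpa [gB] using affBMk_rel (.braid4 (p := p) (q := q) i j hi hj)
  braid3 i j hi hj := by simpa [gB] using affBMk_rel (.braid3 (p := p) (q := q) i j hi hj)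
  comm i j hj := by simpa [gB] using affBMk_rel (.comm (p := p) (q := q) i j hj)
  lusztig i x := by
    have h := affBMk_rel (.lusztig (p := p) (q := q) i x)
    rw [map_smul, map_divDiff_algHom, map_sub, map_mul, map_mul] at h
    exact h

theorem isHeckeD_mk (n : ℕ) (q : K) : IsHeckeD q (TD (n := n) q) (XD q) where
  X_zero := by simpa [XD] using affDMk_rel (.X_zero (n := n) (q := q))
  X_mul x y := by simpa [XD] using affDMk_rel (.X_mul (q := q) x y)
  quad i := by simpa [TD] using affDMk_rel (.quad (q := q) i)
  braid_zero_two i j hi hj := by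
    simpa [TD] using affDMk_rel (.braid_zero_two (q := q) i j hi hj)
  comm_zero i j hi hj hj2 := by
    simpa [TD] using affDMk_rel (.comm_zero (q := q) i j hi hj hj2)
  braid3 i j hi hj := by simpa [TD] using affDMk_rel (.braid3 (q := q) i j hi hj)
  comm i j hi hj := by simpa [TD] using affDMk_rel (.comm (q := q) i j hi hj)
  lusztig i x := by
    have h := affDMk_rel (.lusztig (q := q) i x)
    rw [map_smul, map_divDiff_algHom, map_sub, map_mul, map_mul] at h
    exact h

theorem IsHeckeB.map {n : ℕ} {p q : K} {g : Fin n → A} {X : Lattice n → A}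
    (h : IsHeckeB p q g X) (f : A →ₐ[K] B) :
    IsHeckeB p q (fun i => f (g i)) (fun x => f (X x)) where
  X_zero := by rw [h.X_zero, map_one]
  X_mul x y := by rw [← map_mul, h.X_mul]
  quad i := by rw [← map_pow, h.quad, map_add, map_smul, map_one]
  braid4 i j hi hj := by simp only [← map_mul, h.braid4 i j hi hj]
  braid3 i j hi hj := by simp only [← map_mul, h.braid3 i j hi hj]
  comm i j hj := by simp only [← map_mul, h.comm i j hj]
  lusztig i x := by rw [← map_mul, ← map_mul, ← map_sub, h.lusztig, map_smul, map_divDiff_algHom]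

theorem IsHeckeD.map {n : ℕ} {q : K} {T : Fin n → A} {X : Lattice n → A}
    (h : IsHeckeD q T X) (f : A →ₐ[K] B) :
    IsHeckeD q (fun i => f (T i)) (fun x => f (X x)) where
  X_zero := by rw [h.X_zero, map_one]
  X_mul x y := by rw [← map_mul, h.X_mul]
  quad i := by rw [← map_pow, h.quad, map_add, map_smul, map_one]
  braid_zero_two i j hi hj := by simp only [← map_mul, h.braid_zero_two i j hi hj]
  comm_zero i j hi hj hj2 := by simp only [← map_mul, h.comm_zero i j hi hj hj2]
  braid3 i j hi hj := by simp only [← map_mul, h.braid3 i j hi hj]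
  comm i j hi hj := by simp only [← map_mul, h.comm i j hi hj]
  lusztig i x := by rw [← map_mul, ← map_mul, ← map_sub, h.lusztig, map_smul, map_divDiff_algHom]

/-- The map on generators determined by two families. -/
def genVal {n : ℕ} (g : Fin n → A) (X : Lattice n → A) : Gen n → A
  | Gen.g i => g i
  | Gen.X x => X x

theorem IsHeckeB.lift_rel {n : ℕ} {p q : K} {g : Fin n → A} {X : Lattice n → A}
    (h : IsHeckeB p q g X) ⦃a b : FreeAlgebra K (Gen n)⦄ (hab : RelB n p q a b) :
    FreeAlgebra.lift K (genVal g X) a = FreeAlgebra.lift K (genVal g X) b := by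
  cases hab with
  | X_zero => simpa [genVal] using h.X_zero
  | X_mul x y => simpa [genVal] using h.X_mul x y
  | quad i => simpa [genVal] using h.quad i
  | braid4 i j hi hj => simpa [genVal] using h.braid4 i j hi hj
  | braid3 i j hi hj => simpa [genVal] using h.braid3 i j hi hj
  | comm i j hj => simpa [genVal] using h.comm i j hj
  | lusztig i x =>
    rw [map_smul, map_divDiff_algHom]
    simpa only [map_sub, map_mul, FreeAlgebra.lift_ι_apply, genVal] using h.lusztig i x

theorem IsHeckeD.lift_rel {n : ℕ} {q : K} {T : Fin n → A} {X : Lattice n → A}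
    (h : IsHeckeD q T X) ⦃a b : FreeAlgebra K (Gen n)⦄ (hab : RelD n q a b) :
    FreeAlgebra.lift K (genVal T X) a = FreeAlgebra.lift K (genVal T X) b := by
  cases hab with
  | X_zero => simpa [genVal] using h.X_zero
  | X_mul x y => simpa [genVal] using h.X_mul x y
  | quad i => simpa [genVal] using h.quad i
  | braid_zero_two i j hi hj => simpa [genVal] using h.braid_zero_two i j hi hj
  | comm_zero i j hi hj hj2 => simpa [genVal] using h.comm_zero i j hi hj hj2
  | braid3 i j hi hj => simpa [genVal] using h.braid3 i j hi hj
  | comm i j hi hj => simpa [genVal] using h.comm i j hi hj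
  | lusztig i x =>
    rw [map_smul, map_divDiff_algHom]
    simpa only [map_sub, map_mul, FreeAlgebra.lift_ι_apply, genVal] using h.lusztig i x

/-- The universal property of `Ĥ(B_n)`. -/
def IsHeckeB.lift {n : ℕ} {p q : K} {g : Fin n → A} {X : Lattice n → A}
    (h : IsHeckeB p q g X) : AffB n p q →ₐ[K] A :=
  RingQuot.liftAlgHom K ⟨FreeAlgebra.lift K (genVal g X), h.lift_rel⟩

/-- The universal property of `Ĥ(D_n)`. -/
def IsHeckeD.lift {n : ℕ} {q : K} {T : Fin n → A} {X : Lattice n → A}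
    (h : IsHeckeD q T X) : AffD n q →ₐ[K] A :=
  RingQuot.liftAlgHom K ⟨FreeAlgebra.lift K (genVal T X), h.lift_rel⟩

theorem IsHeckeB.lift_mk {n : ℕ} {p q : K} {g : Fin n → A} {X : Lattice n → A}
    (h : IsHeckeB p q g X) (a : FreeAlgebra K (Gen n)) :
    h.lift (affBMk n p q a) = FreeAlgebra.lift K (genVal g X) a :=
  RingQuot.liftAlgHom_mkAlgHom_apply K (FreeAlgebra.lift K (genVal g X)) h.lift_rel a

theorem IsHeckeD.lift_mk {n : ℕ} {q : K} {T : Fin n → A} {X : Lattice n → A}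
    (h : IsHeckeD q T X) (a : FreeAlgebra K (Gen n)) :
    h.lift (affDMk n q a) = FreeAlgebra.lift K (genVal T X) a :=
  RingQuot.liftAlgHom_mkAlgHom_apply K (FreeAlgebra.lift K (genVal T X)) h.lift_rel a

theorem IsHeckeB.lift_gB {n : ℕ} {p q : K} {g : Fin n → A} {X : Lattice n → A}
    (h : IsHeckeB p q g X) (i : Fin n) : h.lift (gB p q i) = g i := by
  rw [gB, h.lift_mk, FreeAlgebra.lift_ι_apply, genVal]

theorem IsHeckeB.lift_XB {n : ℕ} {p q : K} {g : Fin n → A} {X : Lattice n → A}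
    (h : IsHeckeB p q g X) (x : Lattice n) : h.lift (XB p q x) = X x := by
  rw [XB, h.lift_mk, FreeAlgebra.lift_ι_apply, genVal]

theorem IsHeckeD.lift_TD {n : ℕ} {q : K} {T : Fin n → A} {X : Lattice n → A}
    (h : IsHeckeD q T X) (i : Fin n) : h.lift (TD q i) = T i := by
  rw [TD, h.lift_mk, FreeAlgebra.lift_ι_apply, genVal]

theorem IsHeckeD.lift_XD {n : ℕ} {q : K} {T : Fin n → A} {X : Lattice n → A}
    (h : IsHeckeD q T X) (x : Lattice n) : h.lift (XD q x) = X x := by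
  rw [XD, h.lift_mk, FreeAlgebra.lift_ι_apply, genVal]

theorem affD_hom_ext {n : ℕ} {q : K} {f f' : AffD n q →ₐ[K] A}
    (hT : ∀ i, f (TD q i) = f' (TD q i)) (hX : ∀ x, f (XD q x) = f' (XD q x)) : f = f' := by
  apply RingQuot.ringQuot_ext'
  apply FreeAlgebra.hom_ext
  funext s
  cases s with
  | g i => exact hT i
  | X x => exact hX x

end Families

/-! ### The sign change of the first coordinate -/

section Flip

variable {n : ℕ}

/-- The reflection `r_0` of `L`, changing the sign of the first coordinate. -/
def flip (n : ℕ) : Lattice (n + 2) →+ Lattice (n + 2) where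
  toFun x j := if j = 0 then -x j else x j
  map_zero' := by ext j; simp
  map_add' x y := by ext j; simp only [Pi.add_apply]; split_ifs <;> ring

theorem flip_apply (x : Lattice (n + 2)) (j : Fin (n + 2)) :
    flip n x j = if j = 0 then -x j else x j := rfl

theorem flip_flip (x : Lattice (n + 2)) : flip n (flip n x) = x := by
  ext j
  simp only [flip_apply]
  split_ifs <;> simp

theorem flip_eps_zero : flip n (eps 0) = -eps 0 := by
  ext j
  simp only [flip_apply, eps, Pi.neg_apply]
  split_ifs with h <;> simp [h]

theorem dotProduct_flip (x y : Lattice (n + 2)) : flip n x ⬝ᵥ flip n y = x ⬝ᵥ y := by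
  refine Finset.sum_congr rfl fun j _ => ?_
  simp only [flip_apply]
  split_ifs <;> ring

theorem coroot_flip (α x : Lattice (n + 2)) : coroot (flip n α) (flip n x) = coroot α x := by
  rw [coroot, coroot, dotProduct_flip, dotProduct_flip]

theorem reflect_flip (α x : Lattice (n + 2)) :
    reflect (flip n α) (flip n x) = flip n (reflect α x) := by
  rw [reflect, reflect, coroot_flip, map_sub, map_zsmul]

/-- The quotient depends only on the coroot pairing, which the isometry `flip` preserves, and on
integer translates along `α`, with which the additive map `flip` is compatible. -/
theorem divDiff_flip {A : Type*} [Ring A] (X : Lattice (n + 2) → A) (α x : Lattice (n + 2)) :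
    divDiff X (flip n α) (flip n x) = divDiff (fun y => X (flip n y)) α x := by
  simp only [divDiff, coroot_flip, map_sub, map_add, map_zsmul]

theorem reflect_rootB_zero (x : Lattice (n + 2)) : reflect (rootB 0) x = flip n x := by
  rw [reflect, coroot_rootB_zero 0 rfl, rootB_zero 0 rfl]
  ext j
  simp only [flip_apply, eps, Pi.sub_apply, Pi.smul_apply, Pi.single_apply, smul_eq_mul]
  split_ifs with h
  · subst h; ring
  · ring

theorem rootB_eq_rootD {n : ℕ} (i : Fin n) (hi : i.val ≠ 0) : rootB i = rootD i := by
  rw [rootB, rootD, if_neg hi, if_neg hi]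

/-- Negating `ε_1` exchanges `ε_1 + ε_2` with `ε_2 - ε_1`, and the remaining simple roots do not
involve `ε_1`. This is the automorphism of the `D_n` diagram swapping the two nodes `0` and `1`. -/
theorem flip_rootD (i : Fin (n + 2)) : flip n (rootD i) = rootD (Equiv.swap 0 1 i) := by
  by_cases h0 : i = 0
  · subst h0
    rw [Equiv.swap_apply_left, rootD_pos 1 0 rfl, rootD_zero 0 1 rfl rfl, map_add, flip_eps_zero]
    ext j
    by_cases hj : j = 0 <;> simp [flip_apply, eps, hj, Pi.single_apply]
  by_cases h1 : i = 1
  · subst h1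
    rw [Equiv.swap_apply_right, rootD_pos 1 0 rfl, rootD_zero 0 1 rfl rfl, map_sub, flip_eps_zero]
    ext j
    by_cases hj : j = 0 <;> simp [flip_apply, eps, hj, Pi.single_apply]
  · rw [Equiv.swap_apply_of_ne_of_ne h0 h1]
    have h0' : i.val ≠ 0 := fun h => h0 (Fin.ext h)
    have h1' : i.val ≠ 1 := fun h => h1 (Fin.ext h)
    ext j
    by_cases hj : j = 0
    · subst hj
      simp [flip_apply, rootD, h0', rootA, h0'.symm, h1'.symm]
    · simp [flip_apply, hj]

theorem swap_of_two_le (i : Fin (n + 2)) (hi : 2 ≤ i.val) : Equiv.swap 0 1 i = i :=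
  Equiv.swap_apply_of_ne_of_ne (fun h => by simp [h] at hi) (fun h => by simp [h] at hi)

end Flip

/-! ### Passing between the relations of types `B` and `D` -/

section Passage

variable {K : Type*} [Field K] {A : Type*} [Ring A] [Algebra K A] {n : ℕ} {p q : K}

/-- The nodes `0` and `1` are joined to the rest of the diagram in the same way, so the relations of
`T_0` with `T_j`, `j ≥ 2`, and those of `T_1` trade places. The Lusztig relation is transported by
the isometry `flip`. -/
theorem IsHeckeD.swap {T : Fin (n + 2) → A} {X : Lattice (n + 2) → A} (h : IsHeckeD q T X) :
    IsHeckeD q (fun i => T (Equiv.swap 0 1 i)) (fun x => X (flip n x)) where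
  X_zero := by rw [map_zero, h.X_zero]
  X_mul x y := by rw [h.X_mul, map_add]
  quad i := h.quad _
  braid_zero_two i j hi hj := by
    obtain rfl : i = 0 := Fin.ext hi
    rw [Equiv.swap_apply_left, swap_of_two_le j (by omega)]
    exact h.braid3 1 j le_rfl hj
  comm_zero i j hi hj hj2 := by
    obtain rfl : i = 0 := Fin.ext hi
    rw [Equiv.swap_apply_left]
    by_cases h1 : j.val = 1
    · obtain rfl : j = 1 := Fin.ext h1
      rw [Equiv.swap_apply_right]
      exact (h.comm_zero 0 1 rfl le_rfl (by simp)).symm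
    · rw [swap_of_two_le j (by omega)]
      exact h.comm 1 j le_rfl (by simp; omega)
  braid3 i j hi hij := by
    rw [swap_of_two_le j (by omega)]
    by_cases h1 : i.val = 1
    · obtain rfl : i = 1 := Fin.ext h1
      rw [Equiv.swap_apply_right]
      exact h.braid_zero_two 0 j rfl hij
    · rw [swap_of_two_le i (by omega)]
      exact h.braid3 i j hi hij
  comm i j hi hij := by
    rw [swap_of_two_le j (by omega)]
    by_cases h1 : i.val = 1
    · obtain rfl : i = 1 := Fin.ext h1
      rw [Equiv.swap_apply_right]
      exact h.comm_zero 0 j rfl (by omega) (by omega)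
    · rw [swap_of_two_le i (by omega)]
      exact h.comm i j hi hij
  lusztig i x := by
    rw [← reflect_flip, flip_rootD, h.lusztig, ← flip_rootD, divDiff_flip]

theorem sub_inv_eq_zero_of_sq_eq_one (hp : p ^ 2 = 1) : p - p⁻¹ = 0 := by
  rw [sub_eq_zero, eq_comm]
  exact inv_eq_of_mul_eq_one_left (by rw [← sq, hp])

theorem IsHeckeB.sq_zero {g : Fin (n + 2) → A} {X : Lattice (n + 2) → A}
    (h : IsHeckeB p q g X) (hp : p ^ 2 = 1) : g 0 * g 0 = 1 := by
  have := h.quad 0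
  rwa [param, if_pos (Fin.val_zero _), sub_inv_eq_zero_of_sq_eq_one hp, zero_smul, zero_add, sq] at this

theorem IsHeckeB.zero_mul_X {g : Fin (n + 2) → A} {X : Lattice (n + 2) → A}
    (h : IsHeckeB p q g X) (hp : p ^ 2 = 1) (x : Lattice (n + 2)) :
    g 0 * X x = X (flip n x) * g 0 := by
  have := h.lusztig 0 x
  rwa [param, if_pos (Fin.val_zero _), sub_inv_eq_zero_of_sq_eq_one hp, zero_smul, reflect_rootB_zero,
    sub_eq_zero] at this

/-- The generators of type `D` built from those of type `B`: `T_0 = g_0 g_1 g_0`, and `T_i = g_i`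
for `i ≥ 1`. -/
def typeD (g : Fin (n + 2) → A) (i : Fin (n + 2)) : A := if i = 0 then g 0 * g 1 * g 0 else g i

theorem typeD_zero (g : Fin (n + 2) → A) : typeD g 0 = g 0 * g 1 * g 0 := if_pos rfl

theorem typeD_of_ne (g : Fin (n + 2) → A) {i : Fin (n + 2)} (hi : i ≠ 0) : typeD g i = g i :=
  if_neg hi

/-- Conjugation by the involution `g_0` realises the diagram automorphism: it exchanges `g_1` with
`g_0 g_1 g_0` and fixes `g_i` for `i ≥ 2`. -/
theorem IsHeckeB.zero_mul_typeD {g : Fin (n + 2) → A} {X : Lattice (n + 2) → A}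
    (h : IsHeckeB p q g X) (hp : p ^ 2 = 1) (i : Fin (n + 2)) :
    g 0 * typeD g i = typeD g (Equiv.swap 0 1 i) * g 0 := by
  have h00 := h.sq_zero hp
  by_cases h0 : i = 0
  · subst h0
    rw [Equiv.swap_apply_left, typeD_zero, typeD_of_ne g one_ne_zero, ← mul_assoc, ← mul_assoc,
      h00, one_mul]
  by_cases h1 : i = 1
  · subst h1
    rw [Equiv.swap_apply_right, typeD_zero, typeD_of_ne g one_ne_zero, mul_assoc _ _ (g 0), h00,
      mul_one]
  · have h0' : i.val ≠ 0 := fun h => h0 (Fin.ext h)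
    have h1' : i.val ≠ 1 := fun h => h1 (Fin.ext h)
    rw [Equiv.swap_apply_of_ne_of_ne h0 h1, typeD_of_ne g h0]
    exact h.comm 0 i (by simp; omega)

/-- Most relations for `T_0` are the `g_0`-conjugates of those for `g_1`. The exception is `T_0 T_1
= T_1 T_0`, which is the braid relation of length four. -/
theorem IsHeckeB.isHeckeD {g : Fin (n + 2) → A} {X : Lattice (n + 2) → A}
    (h : IsHeckeB p q g X) (hp : p ^ 2 = 1) : IsHeckeD q (typeD g) X where
  X_zero := h.X_zero
  X_mul := h.X_mul
  quad i := by
    by_cases hi : i = 0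
    · subst hi
      have h1 := h.quad 1
      rw [param, if_neg (by simp)] at h1
      have h00 := h.sq_zero hp
      calc typeD g 0 ^ 2 = g 0 * g 1 * (g 0 * g 0) * g 1 * g 0 := by rw [typeD_zero]; noncomm_ring
        _ = g 0 * g 1 ^ 2 * g 0 := by rw [h00]; noncomm_ring
        _ = (q - q⁻¹) • (g 0 * g 1 * g 0) + g 0 * g 0 := by
          rw [h1, mul_add, add_mul, mul_smul_comm, smul_mul_assoc, mul_one]
        _ = _ := by rw [h00, typeD_zero]
    · rw [typeD_of_ne g hi]
      simpa [param, hi] using h.quad i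
  braid_zero_two i j hi hj := by
    obtain rfl : i = 0 := Fin.ext hi
    have h00 := h.sq_zero hp
    have hj0 : j ≠ 0 := fun h => by simp [h] at hj
    have hc : g 0 * g j = g j * g 0 := h.comm 0 j (by simp; omega)
    have hb : g 1 * g j * g 1 = g j * g 1 * g j := h.braid3 1 j le_rfl hj
    rw [typeD_zero, typeD_of_ne g hj0]
    calc g 0 * g 1 * g 0 * g j * (g 0 * g 1 * g 0)
        = g 0 * g 1 * (g 0 * g j) * g 0 * g 1 * g 0 := by noncomm_ring
      _ = g 0 * g 1 * g j * (g 0 * g 0) * g 1 * g 0 := by rw [hc]; noncomm_ring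
      _ = g 0 * (g 1 * g j * g 1) * g 0 := by rw [h00]; noncomm_ring
      _ = (g 0 * g j) * g 1 * (g j * g 0) := by rw [hb]; noncomm_ring
      _ = (g j * g 0) * g 1 * (g 0 * g j) := by rw [hc]
      _ = g j * (g 0 * g 1 * g 0) * g j := by noncomm_ring
  comm_zero i j hi hj hj2 := by
    obtain rfl : i = 0 := Fin.ext hi
    have hj0 : j ≠ 0 := fun h => by simp [h] at hj
    rw [typeD_zero, typeD_of_ne g hj0]
    by_cases h1 : j.val = 1
    · obtain rfl : j = 1 := Fin.ext h1
      simpa [mul_assoc] using h.braid4 0 1 rfl rfl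
    · have hc : g 0 * g j = g j * g 0 := h.comm 0 j (by simp; omega)
      have hc1 : g 1 * g j = g j * g 1 := h.comm 1 j (by simp; omega)
      exact (((Commute.mul_left (show Commute (g 0) (g j) from hc) hc1).mul_left hc))
  braid3 i j hi hij := by
    rw [typeD_of_ne g (fun h => by simp [h] at hi), typeD_of_ne g (fun h => by simp [h] at hij)]
    exact h.braid3 i j hi hij
  comm i j hi hij := by
    rw [typeD_of_ne g (fun h => by simp [h] at hi), typeD_of_ne g (fun h => by simp [h] at hij)]
    exact h.comm i j hij
  lusztig i x := by
    by_cases hi : i = 0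
    · subst hi
      have h00 := h.sq_zero hp
      have hX := h.zero_mul_X hp
      have hconj (y : Lattice (n + 2)) : g 0 * X y * g 0 = X (flip n y) := by
        rw [hX, mul_assoc, h00, mul_one]
      have hXg (y : Lattice (n + 2)) : X y * g 0 = g 0 * X (flip n y) := by
        rw [hX, flip_flip]
      -- The relation for `T_0` at `x` is the `g_0`-conjugate of the relation for `g_1` at `flip x`.
      have h1 := h.lusztig 1 (flip n x)
      rw [param, if_neg (by simp), rootB_eq_rootD 1 (by simp)] at h1
      have e0 : rootD (0 : Fin (n + 2)) = flip n (rootD 1) := by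
        rw [flip_rootD, Equiv.swap_apply_right]
      have e1 : reflect (rootD 0) x = flip n (reflect (rootD 1) (flip n x)) := by
        rw [e0, ← reflect_flip, flip_flip]
      have e2 : divDiff X (rootD 0) x = g 0 * divDiff X (rootD 1) (flip n x) * g 0 := by
        have hd : divDiff X (flip n (rootD 1)) (flip n (flip n x))
            = g 0 * divDiff X (rootD 1) (flip n x) * g 0 := by
          rw [divDiff_flip]
          simp only [divDiff]
          split_ifs <;> simp [Finset.mul_sum, Finset.sum_mul, hconj]
        rwa [flip_flip, ← e0] at hd
      rw [e1, e2, ← smul_mul_assoc, ← mul_smul_comm, ← h1, typeD_zero, mul_sub, sub_mul,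
        mul_assoc (g 0 * g 1), hX, ← mul_assoc (g 0) (X _), hX]
      simp only [mul_assoc]
    · rw [typeD_of_ne g hi]
      have hi' : i.val ≠ 0 := fun h => hi (Fin.ext h)
      simpa [param, hi, rootB_eq_rootD i hi'] using h.lusztig i x

/-- Adjoining to a family of type `D` an involution implementing the diagram automorphism gives a
family of type `B`. -/
theorem IsHeckeD.isHeckeB {T : Fin (n + 2) → A} {X : Lattice (n + 2) → A} (h : IsHeckeD q T X)
    (hp : p ^ 2 = 1) (w : A) (hw : w * w = 1) (hT : ∀ i, w * T i = T (Equiv.swap 0 1 i) * w)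
    (hX : ∀ x, w * X x = X (flip n x) * w) :
    IsHeckeB p q (fun i => if i = 0 then w else T i) X where
  X_zero := h.X_zero
  X_mul := h.X_mul
  quad i := by
    by_cases hi : i = 0
    · subst hi
      simp [param, sub_inv_eq_zero_of_sq_eq_one hp, sq, hw]
    · simpa [param, hi] using h.quad i
  braid4 i j hi hj := by
    obtain rfl : i = 0 := Fin.ext hi
    obtain rfl : j = 1 := Fin.ext hj
    have h1 : w * T 1 = T 0 * w := by rw [hT, Equiv.swap_apply_right]
    have hc : T 0 * T 1 = T 1 * T 0 := h.comm_zero 0 1 rfl le_rfl (by simp)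
    have h0 : w * T 0 = T 1 * w := by rw [hT, Equiv.swap_apply_left]
    simp only [if_true, one_ne_zero, if_false]
    calc w * T 1 * w * T 1 = (w * T 1) * (w * T 1) := by noncomm_ring
      _ = T 0 * (w * T 0) * w := by rw [h1]; noncomm_ring
      _ = (T 0 * T 1) * (w * w) := by rw [h0]; noncomm_ring
      _ = T 1 * (T 0 * w) * w := by rw [hc]; noncomm_ring
      _ = _ := by rw [← h1]; noncomm_ring
  braid3 i j hi hij := by
    have hi0 : i ≠ 0 := fun h => by simp [h] at hi
    have hj0 : j ≠ 0 := fun h => by simp [h] at hij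
    simpa only [if_neg hi0, if_neg hj0] using h.braid3 i j hi hij
  comm i j hij := by
    have hj0 : j ≠ 0 := fun h => by simp [h] at hij
    by_cases hi : i = 0
    · subst hi
      simp only [if_true, if_neg hj0]
      rw [hT, swap_of_two_le j (Nat.succ_le_of_lt (by simpa using hij))]
    · have hi' : i.val ≠ 0 := fun h => hi (Fin.ext h)
      simpa only [if_neg hi, if_neg hj0] using h.comm i j (by omega) hij
  lusztig i x := by
    by_cases hi : i = 0
    · subst hi
      simp [param, sub_inv_eq_zero_of_sq_eq_one hp, reflect_rootB_zero, hX]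
    · have hi' : i.val ≠ 0 := fun h => hi (Fin.ext h)
      simpa [param, hi, rootB_eq_rootD i hi'] using h.lusztig i x

end Passage

/-! ### Reciprocal polynomials -/

section Reciprocal

variable {K : Type*} [Field K] {A : Type*} [Ring A] [Algebra K A]

/-- For a single factor, `v - a = (-a v)(u - a⁻¹)` when `v` is the inverse of `u`. Recording that
the cofactor commutes with `u` is what allows the factors to be multiplied together in a
noncommutative `A`. -/
theorem exists_aeval_prod_eq_mul {ι : Type*} {u v : A} (huv : u * v = 1) (hvu : v * u = 1)
    (s : Finset ι) (a : ι → K) (ha : ∀ i, a i ≠ 0) (k : ι → ℕ) :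
    ∃ w : A, Commute w u ∧ aeval v (∏ i ∈ s, (X - C (a i)) ^ k i)
      = w * aeval u (∏ i ∈ s, (X - C (a i)⁻¹) ^ k i) := by
  have hmul {f f' g g' : K[X]} (h : ∃ w : A, Commute w u ∧ aeval v f = w * aeval u g)
      (h' : ∃ w : A, Commute w u ∧ aeval v f' = w * aeval u g') :
      ∃ w : A, Commute w u ∧ aeval v (f * f') = w * aeval u (g * g') := by
    obtain ⟨w, hw, e⟩ := h
    obtain ⟨w', hw', e'⟩ := h'
    refine ⟨w * w', hw.mul_left hw', ?_⟩
    have hc : Commute w' (aeval u g) := by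
      rw [aeval_eq_sum_range]
      exact Commute.sum_right _ _ _ fun k _ => (hw'.pow_right k).smul_right _
    rw [map_mul, map_mul, e, e', mul_assoc, ← mul_assoc _ w', ← hc.eq, mul_assoc, mul_assoc]
  have hone : ∃ w : A, Commute w u ∧ aeval v (1 : K[X]) = w * aeval u (1 : K[X]) :=
    ⟨1, Commute.one_left u, by simp⟩
  have hpow {f g : K[X]} (h : ∃ w : A, Commute w u ∧ aeval v f = w * aeval u g) (k : ℕ) :
      ∃ w : A, Commute w u ∧ aeval v (f ^ k) = w * aeval u (g ^ k) := by
    induction k with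
    | zero => rw [pow_zero, pow_zero]; exact hone
    | succ k ih => simpa only [pow_succ] using hmul ih h
  classical
  induction s using Finset.induction_on with
  | empty => rw [Finset.prod_empty, Finset.prod_empty]; exact hone
  | insert i s hi ih =>
    rw [Finset.prod_insert hi, Finset.prod_insert hi]
    refine hmul (hpow ⟨-(a i • v), ?_, ?_⟩ _) ih
    · exact ((show Commute v u from hvu.trans huv.symm).smul_left (a i)).neg_left
    · simp only [map_sub, aeval_X, aeval_C, Algebra.algebraMap_eq_smul_one, mul_sub, neg_mul, smul_neg,
        smul_mul_assoc, hvu, mul_smul_comm, mul_one, smul_smul, inv_mul_cancel₀ (ha i), one_smul]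
      abel

theorem vertexSet_ne_zero {l : ℕ} {q : K} {lam : Fin l → K} (hq : q ≠ 0)
    (hlam : ∀ a, lam a ≠ 0) (i : vertexSet q lam) : (i : K) ≠ 0 := by
  obtain ⟨a, k, h | h⟩ := Set.mem_iUnion.mp i.2
  · rw [h]; exact mul_ne_zero (hlam a) (zpow_ne_zero _ hq)
  · rw [h]; exact mul_ne_zero (inv_ne_zero (hlam a)) (zpow_ne_zero _ hq)

theorem vinv_vinv {l : ℕ} {q : K} {lam : Fin l → K} (i : vertexSet q lam) : vinv (vinv i) = i :=
  Subtype.ext (inv_inv _)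

/-- Inverting the roots of `cycPoly m` only permutes its factors, by symmetry of `m`, so its value
at `v` is a multiple of its value at `u`. -/
theorem aeval_cycPoly_eq_zero_of_inv {l : ℕ} {q : K} {lam : Fin l → K} (hq : q ≠ 0)
    (hlam : ∀ a, lam a ≠ 0) (m : vertexSet q lam →₀ ℕ) (hm : ∀ i, m (vinv i) = m i)
    {u v : A} (huv : u * v = 1) (hvu : v * u = 1) (hu : aeval u (cycPoly m) = 0) :
    aeval v (cycPoly m) = 0 := by
  obtain ⟨w, -, h⟩ := exists_aeval_prod_eq_mul huv hvu m.support (fun i => (i : K))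
    (vertexSet_ne_zero hq hlam) m
  have hP : ∏ i ∈ m.support, (Polynomial.X - C (i : K)⁻¹) ^ m i = cycPoly m := by
    refine Finset.prod_nbij' vinv vinv ?_ ?_ (fun i _ => vinv_vinv i) (fun i _ => vinv_vinv i) ?_
    · intro i hi; simpa [hm] using hi
    · intro i hi; simpa [hm] using hi
    · intro i _; rw [hm]; rfl
  rw [hP, hu, mul_zero] at h
  exact h

end Reciprocal

/-! ### The cyclotomic quotients -/

section Quotients

variable {K : Type*} [Field K] {A : Type*} [Ring A] [Algebra K A] {n : ℕ} {p q : K} {l : ℕ}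
  {lam : Fin l → K} (m : vertexSet q lam →₀ ℕ)

/-- The quotient map `Ĥ(D_n) → H(D_n)_{λ,m}`. -/
def cycDMk (n : ℕ) : AffD n q →ₐ[K] CycD n m := RingQuot.mkAlgHom K (CycRelD n m)

theorem cycDMk_surjective (n : ℕ) : Function.Surjective (cycDMk m n) :=
  RingQuot.mkAlgHom_surjective K _

theorem cycBMk_surjective (n : ℕ) (p : K) : Function.Surjective (cycBMk n p m) :=
  RingQuot.mkAlgHom_surjective K _

theorem aeval_cycDMk : aeval (cycDMk m (n + 2) (XD q (eps 0))) (cycPoly m) = 0 := by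
  rw [aeval_algHom_apply]
  exact (RingQuot.mkAlgHom_rel K (CycRelD.rel (m := m) (0 : Fin (n + 2)) rfl)).trans (map_zero _)

theorem aeval_cycBMk (p : K) :
    aeval (cycBMk (n + 2) p m (XB p q (eps 0))) (cycPoly m) = 0 := by
  rw [aeval_algHom_apply]
  exact (RingQuot.mkAlgHom_rel K (CycRelB.rel (m := m) (p := p) (0 : Fin (n + 2)) rfl)).trans
    (map_zero _)

variable {m}

theorem cycRelD_lift {f : AffD (n + 2) q →ₐ[K] A}
    (hf : aeval (f (XD q (eps 0))) (cycPoly m) = 0) ⦃a b : AffD (n + 2) q⦄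
    (h : CycRelD (n + 2) m a b) : f a = f b := by
  cases h with
  | rel i hi =>
    obtain rfl : i = 0 := Fin.ext hi
    rw [← aeval_algHom_apply, hf, map_zero]

theorem cycRelB_lift {f : AffB (n + 2) p q →ₐ[K] A}
    (hf : aeval (f (XB p q (eps 0))) (cycPoly m) = 0) ⦃a b : AffB (n + 2) p q⦄
    (h : CycRelB (n + 2) p m a b) : f a = f b := by
  cases h with
  | rel i hi =>
    obtain rfl : i = 0 := Fin.ext hi
    rw [← aeval_algHom_apply, hf, map_zero]

/-- The universal property of `H(D_n)_{λ,m}` over `Ĥ(D_n)`. -/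
def cycDLift (f : AffD (n + 2) q →ₐ[K] A) (hf : aeval (f (XD q (eps 0))) (cycPoly m) = 0) :
    CycD (n + 2) m →ₐ[K] A :=
  RingQuot.liftAlgHom K ⟨f, cycRelD_lift hf⟩

/-- The universal property of `H(B_n)_{λ,m}` over `Ĥ(B_n)`. -/
def cycBLift (f : AffB (n + 2) p q →ₐ[K] A) (hf : aeval (f (XB p q (eps 0))) (cycPoly m) = 0) :
    CycB (n + 2) p m →ₐ[K] A :=
  RingQuot.liftAlgHom K ⟨f, cycRelB_lift hf⟩

theorem cycDLift_mk (f : AffD (n + 2) q →ₐ[K] A)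
    (hf : aeval (f (XD q (eps 0))) (cycPoly m) = 0) (a : AffD (n + 2) q) :
    cycDLift f hf (cycDMk m (n + 2) a) = f a :=
  RingQuot.liftAlgHom_mkAlgHom_apply K f (cycRelD_lift hf) a

theorem cycBLift_mk (f : AffB (n + 2) p q →ₐ[K] A)
    (hf : aeval (f (XB p q (eps 0))) (cycPoly m) = 0) (a : AffB (n + 2) p q) :
    cycBLift f hf (cycBMk (n + 2) p m a) = f a :=
  RingQuot.liftAlgHom_mkAlgHom_apply K f (cycRelB_lift hf) a

theorem cycD_hom_ext {f f' : CycD n m →ₐ[K] A}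
    (hT : ∀ i, f (cycDMk m n (TD q i)) = f' (cycDMk m n (TD q i)))
    (hX : ∀ x, f (cycDMk m n (XD q x)) = f' (cycDMk m n (XD q x))) : f = f' := by
  have h : f.comp (cycDMk m n) = f'.comp (cycDMk m n) := affD_hom_ext hT hX
  refine AlgHom.ext fun a => ?_
  obtain ⟨a, rfl⟩ := cycDMk_surjective m n a
  exact DFunLike.congr_fun h a

variable (m)

theorem isHeckeD_cycD (n : ℕ) :
    IsHeckeD q (fun i => cycDMk m n (TD q i)) (fun x => cycDMk m n (XD q x)) :=
  (isHeckeD_mk n q).map _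

theorem isHeckeB_cycB (n : ℕ) (p : K) :
    IsHeckeB p q (fun i => cycBMk n p m (gB p q i)) (fun x => cycBMk n p m (XB p q x)) :=
  (isHeckeB_mk n p q).map _

/-- The twisted family has `X_1⁻¹` in place of `X_1`; this is the condition for the diagram
automorphism to descend to the cyclotomic quotient. -/
theorem aeval_flip_eps (hq : q ≠ 0) (hlam : ∀ a, lam a ≠ 0) (hm : ∀ i, m (vinv i) = m i) :
    aeval ((isHeckeD_cycD m (n + 2)).swap.lift (XD q (eps 0))) (cycPoly m) = 0 := by
  have h := isHeckeD_cycD m (n + 2)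
  rw [IsHeckeD.lift_XD, flip_eps_zero]
  refine aeval_cycPoly_eq_zero_of_inv hq hlam m hm ?_ ?_ (aeval_cycDMk m)
  · rw [h.X_mul, add_neg_cancel, h.X_zero]
  · rw [h.X_mul, neg_add_cancel, h.X_zero]

end Quotients

/-! ### Crossed product structure of the type `B` quotient -/

section Main

variable {K : Type*} [Field K] {n : ℕ} {p q : K} {l : ℕ}
  {lam : Fin l → K} (m : vertexSet q lam →₀ ℕ)

/-- The diagram automorphism of `H(D_n)_{λ,m}`: it exchanges `T_0` and `T_1`, and acts on the
`X^x` through the sign change of the first coordinate. -/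
def sigma (n : ℕ) (hq : q ≠ 0) (hlam : ∀ a, lam a ≠ 0) (hm : ∀ i, m (vinv i) = m i) :
    CycD (n + 2) m →ₐ[K] CycD (n + 2) m :=
  cycDLift (isHeckeD_cycD m (n + 2)).swap.lift (aeval_flip_eps m hq hlam hm)

theorem sigma_T (hq : q ≠ 0) (hlam : ∀ a, lam a ≠ 0) (hm : ∀ i, m (vinv i) = m i)
    (i : Fin (n + 2)) : sigma m n hq hlam hm (cycDMk m (n + 2) (TD q i))
      = cycDMk m (n + 2) (TD q (Equiv.swap 0 1 i)) := by
  rw [sigma, cycDLift_mk, IsHeckeD.lift_TD]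

theorem sigma_X (hq : q ≠ 0) (hlam : ∀ a, lam a ≠ 0) (hm : ∀ i, m (vinv i) = m i)
    (x : Lattice (n + 2)) : sigma m n hq hlam hm (cycDMk m (n + 2) (XD q x))
      = cycDMk m (n + 2) (XD q (flip n x)) := by
  rw [sigma, cycDLift_mk, IsHeckeD.lift_XD]

theorem sigma_sigma (hq : q ≠ 0) (hlam : ∀ a, lam a ≠ 0) (hm : ∀ i, m (vinv i) = m i)
    (a : CycD (n + 2) m) : sigma m n hq hlam hm (sigma m n hq hlam hm a) = a := by
  have h : (sigma m n hq hlam hm).comp (sigma m n hq hlam hm) = AlgHom.id K _ := by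
    apply cycD_hom_ext
    · intro i; simp [sigma_T]
    · intro x; simp [sigma_X, flip_flip]
  exact DFunLike.congr_fun h a

/-- The embedding `H(D_n)_{λ,m} → H(B_n)_{λ,m}`, `T_0 ↦ g_0 g_1 g_0`. -/
def inclusion (n : ℕ) (hp : p ^ 2 = 1) : CycD (n + 2) m →ₐ[K] CycB (n + 2) p m :=
  cycDLift ((isHeckeB_cycB m (n + 2) p).isHeckeD hp).lift
    (by rw [IsHeckeD.lift_XD]; exact aeval_cycBMk m p)

theorem inclusion_T (hp : p ^ 2 = 1) (i : Fin (n + 2)) :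
    inclusion m n hp (cycDMk m (n + 2) (TD q i))
      = typeD (fun i => cycBMk (n + 2) p m (gB p q i)) i := by
  rw [inclusion, cycDLift_mk, IsHeckeD.lift_TD]

theorem inclusion_X (hp : p ^ 2 = 1) (x : Lattice (n + 2)) :
    inclusion m n hp (cycDMk m (n + 2) (XD q x)) = cycBMk (n + 2) p m (XB p q x) := by
  rw [inclusion, cycDLift_mk, IsHeckeD.lift_XD]

/-- Conjugation by an element `w` with `w * w = 1`. -/
def conjAlgHom {A : Type*} [Ring A] [Algebra K A] (w : A) (hw : w * w = 1) : A →ₐ[K] A :=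
  AlgHom.ofLinearMap ((LinearMap.mulLeft K w).comp (LinearMap.mulRight K w))
    (by simp [hw]) (fun a b => by
      simp only [LinearMap.comp_apply, LinearMap.mulLeft_apply, LinearMap.mulRight_apply]
      calc w * (a * b * w) = w * a * 1 * b * w := by noncomm_ring
        _ = w * (a * w) * (w * (b * w)) := by rw [← hw]; noncomm_ring)

theorem conjAlgHom_apply {A : Type*} [Ring A] [Algebra K A] (w : A) (hw : w * w = 1) (a : A) :
    conjAlgHom (K := K) w hw a = w * (a * w) := rfl

/-- Conjugation by `g_0` after `inclusion`, and `inclusion` after `sigma`, are both algebra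
homomorphisms, so comparing them on generators suffices. -/
theorem zero_mul_inclusion (hq : q ≠ 0) (hlam : ∀ a, lam a ≠ 0) (hm : ∀ i, m (vinv i) = m i)
    (hp : p ^ 2 = 1) (a : CycD (n + 2) m) :
    cycBMk (n + 2) p m (gB p q 0) * inclusion m n hp a
      = inclusion m n hp (sigma m n hq hlam hm a) * cycBMk (n + 2) p m (gB p q 0) := by
  have hB := isHeckeB_cycB m (n + 2) p
  have hw := hB.sq_zero hp
  have h : (conjAlgHom _ hw).comp (inclusion m n hp)
      = (inclusion m n hp).comp (sigma m n hq hlam hm) := by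
    apply cycD_hom_ext
    · intro i
      simp only [AlgHom.comp_apply, conjAlgHom_apply, sigma_T, inclusion_T]
      rw [← mul_assoc, hB.zero_mul_typeD hp, mul_assoc, hw, mul_one]
    · intro x
      simp only [AlgHom.comp_apply, conjAlgHom_apply, sigma_X, inclusion_X]
      rw [← mul_assoc, hB.zero_mul_X hp, mul_assoc, hw, mul_one]
  have h' := DFunLike.congr_fun h a
  simp only [AlgHom.comp_apply, conjAlgHom_apply] at h'
  rw [← h', mul_assoc, mul_assoc, hw, mul_one]

/-- Such sums contain the generators and are closed under addition and, since `g_0` normalises the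
image of `inclusion` and squares to one, under multiplication. -/
theorem exists_inclusion_add (hq : q ≠ 0) (hlam : ∀ a, lam a ≠ 0)
    (hm : ∀ i, m (vinv i) = m i) (hp : p ^ 2 = 1) (x : CycB (n + 2) p m) :
    ∃ a b, x = inclusion m n hp a + inclusion m n hp b * cycBMk (n + 2) p m (gB p q 0) := by
  obtain ⟨x, rfl⟩ := cycBMk_surjective m (n + 2) p x
  obtain ⟨x, rfl⟩ := RingQuot.mkAlgHom_surjective K (RelB (n + 2) p q) x
  change ∃ a b, cycBMk (n + 2) p m (affBMk (n + 2) p q x) = _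
  have hw := (isHeckeB_cycB m (n + 2) p).sq_zero hp
  have hc := zero_mul_inclusion (n := n) m hq hlam hm hp
  induction x using FreeAlgebra.induction with
  | grade0 r => exact ⟨algebraMap K _ r, 0, by simp⟩
  | grade1 s =>
    cases s with
    | g i =>
      by_cases hi : i = 0
      · subst hi
        exact ⟨0, 1, by rw [map_zero, map_one, zero_add, one_mul]; rfl⟩
      · exact ⟨cycDMk m (n + 2) (TD q i), 0, by
          rw [map_zero, zero_mul, add_zero, inclusion_T, typeD_of_ne _ hi]; rfl⟩
    | X x =>
      exact ⟨cycDMk m (n + 2) (XD q x), 0, by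
        rw [map_zero, zero_mul, add_zero, inclusion_X]; rfl⟩
  | mul x y hx hy =>
    obtain ⟨a, b, hx⟩ := hx
    obtain ⟨c, d, hy⟩ := hy
    -- The crossed product rule: expand `(a + b w)(c + d w)` using `w c = σ(c) w`, `w d = σ(d) w`
    -- and `w * w = 1`.
    refine ⟨a * c + b * sigma m n hq hlam hm d, a * d + b * sigma m n hq hlam hm c, ?_⟩
    rw [map_mul, map_mul, hx, hy, map_add, map_add, map_mul, map_mul, map_mul, map_mul]
    have hc1 := hc c
    have hc2 := hc d
    generalize cycBMk (n + 2) p m (gB p q 0) = w at *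
    calc _ = inclusion m n hp a * inclusion m n hp c + inclusion m n hp b * (w * inclusion m n hp d)
          * w + (inclusion m n hp a * inclusion m n hp d * w
            + inclusion m n hp b * (w * inclusion m n hp c)) := by noncomm_ring
      _ = inclusion m n hp a * inclusion m n hp c
          + inclusion m n hp b * inclusion m n hp (sigma m n hq hlam hm d) * (w * w)
          + (inclusion m n hp a * inclusion m n hp d * w
            + inclusion m n hp b * inclusion m n hp (sigma m n hq hlam hm c) * w) := by
        rw [hc1, hc2]; noncomm_ring
      _ = _ := by rw [hw]; noncomm_ring
  | add x y hx hy =>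
    obtain ⟨a, b, hx⟩ := hx
    obtain ⟨c, d, hy⟩ := hy
    refine ⟨a + c, b + d, ?_⟩
    rw [map_add, map_add, hx, hy, map_add, map_add, add_mul]
    abel

/-- The diagonal embedding `a ↦ diag(a, θ(a))` attached to an algebra endomorphism `θ`. -/
def twistedDiagonal {A : Type*} [Ring A] [Algebra K A] (θ : A →ₐ[K] A) :
    A →ₐ[K] Matrix (Fin 2) (Fin 2) A :=
  (Matrix.diagonalAlgHom K).comp (AlgHom.pi ![AlgHom.id K A, θ])

theorem twistedDiagonal_apply {A : Type*} [Ring A] [Algebra K A] (θ : A →ₐ[K] A) (a : A) :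
    twistedDiagonal θ a = !![a, 0; 0, θ a] := by
  ext i j
  fin_cases i <;> fin_cases j <;> simp [twistedDiagonal]

theorem antidiagonal_mul_twistedDiagonal {A : Type*} [Ring A] [Algebra K A] (θ : A →ₐ[K] A)
    (hθ : ∀ a, θ (θ a) = a) (a : A) :
    !![0, 1; 1, 0] * twistedDiagonal θ a = twistedDiagonal θ (θ a) * !![0, 1; 1, 0] := by
  simp [twistedDiagonal_apply, hθ]

/-- The matrices `diag(a, σ(a))`, together with the permutation matrix in the role of `g_0`, satisfy
the type `B` relations. The resulting representation `Ψ`, composed with `inclusion`, is the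
injective map `Δ`. -/
theorem inclusion_injective (hq : q ≠ 0) (hlam : ∀ a, lam a ≠ 0) (hm : ∀ i, m (vinv i) = m i)
    (hp : p ^ 2 = 1) : Function.Injective (inclusion m n hp) := by
  let Δ := twistedDiagonal (sigma m n hq hlam hm)
  have hσ := sigma_sigma (n := n) m hq hlam hm
  have hw : (!![0, 1; 1, 0] : Matrix (Fin 2) (Fin 2) (CycD (n + 2) m)) * !![0, 1; 1, 0] = 1 := by
    simp [Matrix.one_fin_two]
  have hB := ((isHeckeD_cycD m (n + 2)).map Δ).isHeckeB hp _ hw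
    (fun i => by rw [antidiagonal_mul_twistedDiagonal _ hσ, sigma_T])
    (fun x => by rw [antidiagonal_mul_twistedDiagonal _ hσ, sigma_X])
  let Ψ : CycB (n + 2) p m →ₐ[K] Matrix (Fin 2) (Fin 2) (CycD (n + 2) m) :=
    cycBLift hB.lift (by rw [hB.lift_XB, aeval_algHom_apply, aeval_cycDMk, map_zero])
  have hg (i : Fin (n + 2)) : Ψ (cycBMk (n + 2) p m (gB p q i))
      = if i = 0 then !![0, 1; 1, 0] else Δ (cycDMk m (n + 2) (TD q i)) := by
    rw [cycBLift_mk, hB.lift_gB]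
  have h : Ψ.comp (inclusion m n hp) = Δ := by
    apply cycD_hom_ext
    · intro i
      rw [AlgHom.comp_apply, inclusion_T]
      by_cases hi : i = 0
      · subst hi
        rw [typeD_zero, map_mul, map_mul, hg, hg, if_pos rfl, if_neg one_ne_zero,
          antidiagonal_mul_twistedDiagonal _ hσ, mul_assoc, hw, mul_one, sigma_T,
          Equiv.swap_apply_right]
      · rw [typeD_of_ne _ hi, hg, if_neg hi]
    · intro x
      rw [AlgHom.comp_apply, inclusion_X, cycBLift_mk, hB.lift_XB]
  intro a b hab
  have h' : Δ a = Δ b := by rw [← h, AlgHom.comp_apply, AlgHom.comp_apply, hab]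
  -- The upper left entry of `Δ a` is `a` itself.
  simpa [Δ, twistedDiagonal_apply] using congrFun (congrFun h' 0) 0

/-! ### Fixed points of the involution -/

theorem etaCyc_mk (hp : p ^ 2 = 1) (x : AffB n p q) :
    etaCyc n hp m (cycBMk n p m x) = cycBMk n p m (eta n q hp x) := etaCycHom_mk n hp m x

/-- The two signs in `g_0 g_1 g_0` cancel, and no other generator of the image involves `g_0`. -/
theorem etaCyc_inclusion (hp : p ^ 2 = 1) (a : CycD (n + 2) m) :
    etaCyc (n + 2) hp m (inclusion m n hp a) = inclusion m n hp a := by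
  have h : (etaCyc (n + 2) hp m).toAlgHom.comp (inclusion m n hp) = inclusion m n hp := by
    apply cycD_hom_ext
    · intro i
      change etaCyc (n + 2) hp m (inclusion m n hp _) = _
      rw [inclusion_T]
      by_cases hi : i = 0
      · subst hi
        simp [typeD_zero, etaCyc_mk, eta_gB]
      · simp [typeD_of_ne _ hi, etaCyc_mk, eta_gB, hi]
    · intro x
      change etaCyc (n + 2) hp m (inclusion m n hp _) = _
      rw [inclusion_X, etaCyc_mk, eta_XB]
  exact DFunLike.congr_fun h a

theorem exists_inclusion_eq (hchar : (2 : K) ≠ 0) (hq : q ≠ 0) (hlam : ∀ a, lam a ≠ 0)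
    (hm : ∀ i, m (vinv i) = m i) (hp : p ^ 2 = 1) (x : CycB (n + 2) p m)
    (hx : etaCyc (n + 2) hp m x = x) : ∃ a, inclusion m n hp a = x := by
  obtain ⟨a, b, rfl⟩ := exists_inclusion_add m hq hlam hm hp x
  -- Invariance of `ι(a) + ι(b) g_0` becomes `2 ι(b) g_0 = 0`, so the whole second summand vanishes.
  rw [map_add, map_mul, etaCyc_inclusion, etaCyc_inclusion, etaCyc_mk, eta_gB, if_pos (Fin.val_zero _), map_neg,
    mul_neg, add_right_inj, neg_eq_iff_add_eq_zero, ← two_smul K] at hx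
  exact ⟨a, by rw [(smul_eq_zero.mp hx).resolve_left hchar, add_zero]⟩

end Main

end AffineHecke

end

theorem mainTheorem4 {K : Type*} [Field K] (hchar : (2 : K) ≠ 0)
    (p q : K) (hp : p ^ 2 = 1) (hq : q ≠ 0)
    (n : ℕ) (hn : 2 ≤ n)
    (l : ℕ) (lam : Fin l → K) (hlam : ∀ a, lam a ≠ 0)
    (hdisj : ∀ a b, a ≠ b →
      Disjoint (AffineHecke.orbitSet q (lam a)) (AffineHecke.orbitSet q (lam b)))
    (m : AffineHecke.vertexSet q lam →₀ ℕ)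
    (hm : ∀ i : AffineHecke.vertexSet q lam, m (AffineHecke.vinv i) = m i) :
    Nonempty (AffineHecke.CycD n m ≃ₐ[K]
      AffineHecke.fixedSubalgebra (AffineHecke.etaCyc n hp m)) := by
  obtain ⟨n, rfl⟩ := Nat.exists_eq_add_of_le' hn
  refine ⟨AlgEquiv.ofBijective ((AffineHecke.inclusion m n hp).codRestrict _
    (AffineHecke.etaCyc_inclusion m hp)) ⟨?_, ?_⟩⟩
  · exact (AlgHom.injective_codRestrict _ _ _).mpr
      (AffineHecke.inclusion_injective m hq hlam hm hp)
  · rintro ⟨x, hx⟩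
    obtain ⟨a, ha⟩ := AffineHecke.exists_inclusion_eq m hchar hq hlam hm hp x hx
    exact ⟨a, Subtype.ext ha⟩
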